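/- Let $\mathcal P_n=\{\mathbf p=(p_1,\dots,p_n): p_1\ge\dots\ge p_n\ge 0,\ \sum_{i=1}^n p_i=1\}$, partially ordered by majorization: $\mathbf p\preceq\mathbf q$ if and only if $\sum_{i=1}^k p_i\le\sum_{i=1}^k q_i$ for $k=1,\dots,n$. This partial order is a lattice; denote by $\mathbf p\wedge\mathbf q$ and $\mathbf p\vee\mathbf q$ the greatest lower bound and the least upper bound of $\mathbf p$ and $\mathbf q$. For real $\alpha>0$ and real $\beta$, the Sharma–Mittal entropy of $\mathbf p\in\mathcal P_n$ is $$S_{\alpha,\beta}(\mathbf p)=\frac{1}{1-\beta}\left[\Big(\sum_{i=1}^n p_i^\alpha\Big)^{\frac{1-\beta}{1-\alpha}}-1\right]\qquad(\alpha\ne1,\ \beta\neq 1),$$ extended by continuity in the parameters to $\alpha=1$ and to $\beta=1$: with $H(\mathbf p)=-\sum_{i=1}^n p_i\log_2p_i$ (where $0\log_2 0=0$), $$S_{1,\beta}(\mathbf p)=\frac{2^{(1-\beta)H(\mathbf p)}-1}{1-\beta}\ (\beta\ne1),\qquad S_{\alpha,1}(\mathbf p)=\frac{1}{1-\alpha}\ln\sum_{i=1}^n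 p_i^\alpha\ (\alpha\neq 1),\qquad S_{1,1}(\mathbf p)=\ln(2)\,H(\mathbf p).$$ Theorem. Let $\alpha>0$ and $\beta\le\alpha$. Then $S_{\alpha,\beta}$ is supermodular on the majorization lattice: for all $\mathbf p,\mathbf q\in\mathcal P_n$, $$S_{\alpha,\beta}(\mathbf p)+S_{\alpha,\beta}(\mathbf q)\le S_{\alpha,\beta}(\mathbf p\wedge\mathbf q)+S_{\alpha,\beta}(\mathbf p\vee\mathbf q).$$ -/

import Mathlib

/-- `OrderedSimplex n` is the set `𝒫ₙ` of probability vectors `p = (p₁, …, pₙ)` whose components are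
arranged in non-increasing order. -/
@[ext]
structure OrderedSimplex (n : ℕ) where
  /-- the components of the vector -/
  val : Fin n → ℝ
  nonneg : ∀ i, 0 ≤ val i
  sum_eq_one : ∑ i, val i = 1
  antitone : Antitone val

namespace OrderedSimplex

variable {n : ℕ}

/-- The sum `p₁ + ⋯ + pₖ` of the first `k` components. -/
def cumSum (p : OrderedSimplex n) (k : ℕ) : ℝ :=
  ∑ i : Fin n with i.val < k, p.val i

theorem cumSum_zero (p : OrderedSimplex n) : p.cumSum 0 = 0 := by
  simp [cumSum]

theorem cumSum_last (p : OrderedSimplex n) : p.cumSum n = 1 := by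
  simp [cumSum, p.sum_eq_one]

theorem sum_filter_succ (f : Fin n → ℝ) (i : Fin n) :
    (∑ j : Fin n with j.val < i.val + 1, f j) = (∑ j : Fin n with j.val < i.val, f j) + f i := by
  have h : (Finset.univ.filter fun j : Fin n => j.val < i.val + 1)
      = insert i (Finset.univ.filter fun j : Fin n => j.val < i.val) := by
    ext j
    simp only [Finset.mem_filter, Finset.mem_univ, true_and, Finset.mem_insert, Fin.ext_iff]
    omega
  rw [h, Finset.sum_insert (by simp), add_comm]

theorem cumSum_succ (p : OrderedSimplex n) (i : Fin n) :
    p.cumSum (i.val + 1) = p.cumSum i.val + p.val i :=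
  sum_filter_succ p.val i

/-- Majorization: `p ≼ q` if `p₁ + ⋯ + pₖ ≤ q₁ + ⋯ + qₖ` for `k = 1, …, n`. It is a partial order
on `𝒫ₙ`. -/
instance : PartialOrder (OrderedSimplex n) where
  le p q := ∀ k : ℕ, 1 ≤ k → k ≤ n → p.cumSum k ≤ q.cumSum k
  le_refl _ _ _ _ := le_rfl
  le_trans _ _ _ h₁ h₂ k hk hkn := (h₁ k hk hkn).trans (h₂ k hk hkn)
  le_antisymm p q h₁ h₂ := by
    have h : ∀ k : ℕ, k ≤ n → p.cumSum k = q.cumSum k := by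
      intro k hk
      rcases Nat.eq_zero_or_pos k with rfl | h0
      · rw [cumSum_zero, cumSum_zero]
      · exact le_antisymm (h₁ k h0 hk) (h₂ k h0 hk)
    ext i
    have e₁ := p.cumSum_succ i
    have e₂ := q.cumSum_succ i
    have e₃ := h i.val i.isLt.le
    have e₄ := h (i.val + 1) i.isLt
    linarith

theorem le_def (p q : OrderedSimplex n) :
    p ≤ q ↔ ∀ k : ℕ, 1 ≤ k → k ≤ n → p.cumSum k ≤ q.cumSum k := Iff.rfl

theorem cumSum_mono {p q : OrderedSimplex n} (h : p ≤ q) {k : ℕ} (hk : k ≤ n) :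
    p.cumSum k ≤ q.cumSum k := by
  rcases Nat.eq_zero_or_pos k with rfl | h0
  · rw [cumSum_zero, cumSum_zero]
  · exact h k h0 hk

theorem cumSum_le_succ (p : OrderedSimplex n) {k : ℕ} (hk : k < n) :
    p.cumSum k ≤ p.cumSum (k + 1) := by
  have e := p.cumSum_succ ⟨k, hk⟩
  have h := p.nonneg ⟨k, hk⟩
  simp only at e
  linarith

theorem cumSum_concave (p : OrderedSimplex n) {k : ℕ} (hk : k + 1 < n) :
    p.cumSum k + p.cumSum (k + 2) ≤ 2 * p.cumSum (k + 1) := by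
  have e₁ := p.cumSum_succ ⟨k, by omega⟩
  have e₂ := p.cumSum_succ ⟨k + 1, hk⟩
  have h : p.val ⟨k + 1, hk⟩ ≤ p.val ⟨k, by omega⟩ :=
    p.antitone (Fin.mk_le_mk.mpr (Nat.le_succ k))
  simp only [add_assoc, Nat.reduceAdd] at e₁ e₂
  linarith

/-- The element of `𝒫ₙ` whose partial sums are a given concave non-decreasing sequence
`F 0 = 0, F 1, …, F n = 1`. -/
def ofCumSum (F : ℕ → ℝ) (h0 : F 0 = 0) (h1 : F n = 1) (hm : ∀ k, k < n → F k ≤ F (k + 1))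
    (hc : ∀ k, k + 1 < n → F k + F (k + 2) ≤ 2 * F (k + 1)) : OrderedSimplex n where
  val i := F (i.val + 1) - F i.val
  nonneg i := sub_nonneg.mpr (hm i.val i.isLt)
  sum_eq_one := by
    rw [Fin.sum_univ_eq_sum_range (fun i => F (i + 1) - F i) n, Finset.sum_range_sub, h0, h1,
      sub_zero]
  antitone := by
    have key : ∀ (d a : ℕ), a + d < n → F (a + d + 1) - F (a + d) ≤ F (a + 1) - F a := by
      intro d
      induction d with
      | zero => intro a _; exact le_rfl
      | succ d ih =>
        intro a ha
        have e₁ := ih a (by omega)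
        have e₂ := hc (a + d) (by omega)
        rw [← add_assoc a d 1, add_assoc (a + d) 1 1, one_add_one_eq_two]
        linarith
    intro i j hij
    have hij' : i.val ≤ j.val := hij
    have e := key (j.val - i.val) i.val (by have := j.isLt; omega)
    rwa [Nat.add_sub_cancel' hij'] at e

theorem cumSum_ofCumSum (F : ℕ → ℝ) (h0 : F 0 = 0) (h1 : F n = 1)
    (hm : ∀ k, k < n → F k ≤ F (k + 1))
    (hc : ∀ k, k + 1 < n → F k + F (k + 2) ≤ 2 * F (k + 1)) {k : ℕ} (hk : k ≤ n) :
    (ofCumSum F h0 h1 hm hc).cumSum k = F k := by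
  induction k with
  | zero => rw [cumSum_zero, h0]
  | succ k ih =>
    have e := (ofCumSum F h0 h1 hm hc).cumSum_succ ⟨k, hk⟩
    simp only at e
    rw [e, ih (by omega)]
    simp [ofCumSum]

/-- The greatest lower bound `p ∧ q`: its partial sums are the minima of those of `p` and `q`. -/
def glb (p q : OrderedSimplex n) : OrderedSimplex n :=
  ofCumSum (fun k => min (p.cumSum k) (q.cumSum k))
    (by simp only [cumSum_zero, min_self])
    (by simp only [cumSum_last, min_self])
    (fun _ hk => min_le_min (p.cumSum_le_succ hk) (q.cumSum_le_succ hk))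
    (fun k hk => by
      have e₁ := p.cumSum_concave hk
      have e₂ := q.cumSum_concave hk
      have a₁ := min_le_left (p.cumSum k) (q.cumSum k)
      have a₂ := min_le_right (p.cumSum k) (q.cumSum k)
      have b₁ := min_le_left (p.cumSum (k + 2)) (q.cumSum (k + 2))
      have b₂ := min_le_right (p.cumSum (k + 2)) (q.cumSum (k + 2))
      rcases min_choice (p.cumSum (k + 1)) (q.cumSum (k + 1)) with h | h <;>
        rw [h] <;> linarith)

theorem bddBelow_cumSum (A : Set (OrderedSimplex n)) (k : ℕ) :
    BddBelow (Set.range fun r : A => r.val.cumSum k) :=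
  ⟨0, by rintro _ ⟨r, rfl⟩; exact Finset.sum_nonneg fun i _ => r.val.nonneg i⟩

theorem nonempty_upperBounds (p q : OrderedSimplex n) :
    Nonempty (upperBounds ({p, q} : Set (OrderedSimplex n))) := by
  have hn : n ≠ 0 := by
    rintro rfl
    have := p.sum_eq_one
    simp at this
  let F : ℕ → ℝ := fun k => if k = 0 then 0 else 1
  let t : OrderedSimplex n := ofCumSum F (by simp [F]) (by simp [F, hn])
    (fun k _ => by by_cases h : k = 0 <;> simp [F, h])
    (fun k _ => by by_cases h : k = 0 <;> norm_num [F, h])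
  have ht : ∀ r : OrderedSimplex n, r ≤ t := by
    intro r k hk hkn
    have e : t.cumSum k = F k := cumSum_ofCumSum _ _ _ _ _ hkn
    have hF : F k = 1 := if_neg (by omega)
    rw [e, hF, ← r.sum_eq_one]
    exact Finset.sum_le_sum_of_subset_of_nonneg (Finset.filter_subset _ _)
      (fun i _ _ => r.nonneg i)
  exact ⟨⟨t, fun r _ => ht r⟩⟩

/-- The least upper bound `p ∨ q`: each partial sum is the infimum of the corresponding partial
sums of all the upper bounds of `p` and `q`. -/
noncomputable def lub (p q : OrderedSimplex n) : OrderedSimplex n :=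
  haveI := nonempty_upperBounds p q
  ofCumSum (fun k => ⨅ r : upperBounds ({p, q} : Set (OrderedSimplex n)), r.val.cumSum k)
    (by simp only [cumSum_zero, ciInf_const])
    (by simp only [cumSum_last, ciInf_const])
    (fun k hk => ciInf_mono (bddBelow_cumSum _ k) fun r => r.val.cumSum_le_succ hk)
    (fun k hk => by
      rw [← div_le_iff₀' (two_pos : (0 : ℝ) < 2)]
      refine le_ciInf fun r => ?_
      have e := r.val.cumSum_concave hk
      have a := ciInf_le (bddBelow_cumSum _ k) r
      have b := ciInf_le (bddBelow_cumSum _ (k + 2)) r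
      rw [div_le_iff₀' two_pos]
      linarith)

theorem cumSum_glb (p q : OrderedSimplex n) {k : ℕ} (hk : k ≤ n) :
    (glb p q).cumSum k = min (p.cumSum k) (q.cumSum k) :=
  cumSum_ofCumSum _ _ _ _ _ hk

theorem cumSum_lub (p q : OrderedSimplex n) {k : ℕ} (hk : k ≤ n) :
    (lub p q).cumSum k
      = ⨅ r : upperBounds ({p, q} : Set (OrderedSimplex n)), r.val.cumSum k :=
  cumSum_ofCumSum _ _ _ _ _ hk

theorem le_lub_of_mem {p q s : OrderedSimplex n} (hs : s ∈ ({p, q} : Set (OrderedSimplex n))) :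
    s ≤ lub p q := by
  intro k _ hkn
  have := nonempty_upperBounds p q
  rw [cumSum_lub p q hkn]
  exact le_ciInf fun r => cumSum_mono (r.property hs) hkn

/-- The majorization lattice `(𝒫ₙ, ≼, ∧, ∨)`, with `∧` and `∨` written `⊓` and `⊔`. -/
noncomputable instance : Lattice (OrderedSimplex n) where
  inf := glb
  sup := lub
  inf_le_left p q k _ hkn := by rw [cumSum_glb p q hkn]; exact min_le_left _ _
  inf_le_right p q k _ hkn := by rw [cumSum_glb p q hkn]; exact min_le_right _ _
  le_inf p q r hq hr k hk hkn := by
    rw [cumSum_glb q r hkn]; exact le_min (hq k hk hkn) (hr k hk hkn)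
  le_sup_left p q := le_lub_of_mem (Set.mem_insert p {q})
  le_sup_right p q := le_lub_of_mem (Set.mem_insert_of_mem p rfl)
  sup_le p q r hp hq k hk hkn := by
    have hr : r ∈ upperBounds ({p, q} : Set (OrderedSimplex n)) := by
      rintro s (rfl | rfl)
      · exact hp
      · exact hq
    rw [cumSum_lub p q hkn]
    exact ciInf_le (bddBelow_cumSum _ k) ⟨r, hr⟩

/-- The Shannon entropy `H(p) = -∑ pᵢ log₂ pᵢ` (with `0 log 0 = 0`). -/
noncomputable def shannonEntropy (p : OrderedSimplex n) : ℝ :=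
  -∑ i, p.val i * Real.logb 2 (p.val i)

/-- The Rényi entropy `H_α(p) = (1 - α)⁻¹ log₂ (∑ pᵢ ^ α)` of finite order `α`; for `α = 1` it is
the Shannon entropy. -/
noncomputable def renyiEntropy (α : ℝ) (p : OrderedSimplex n) : ℝ :=
  if α = 1 then shannonEntropy p
  else 1 / (1 - α) * Real.logb 2 (∑ i, p.val i ^ α)

/-- The Sharma–Mittal entropy `S_{α,β}(p)`, given for `α ≠ 1`, `β ≠ 1` by
`(1 - β)⁻¹ ((∑ pᵢ ^ α) ^ ((1 - β) / (1 - α)) - 1)`, and for `α = 1` or `β = 1` by continuous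
extension in the parameters. -/
noncomputable def sharmaMittalEntropy (α β : ℝ) (p : OrderedSimplex n) : ℝ :=
  if β = 1 then Real.log 2 * renyiEntropy α p
  else if α = 1 then ((2 : ℝ) ^ ((1 - β) * shannonEntropy p) - 1) / (1 - β)
  else 1 / (1 - β) * ((∑ i, p.val i ^ α) ^ ((1 - β) / (1 - α)) - 1)

end OrderedSimplex

/-! The core is the trace form `∑ φ (pᵢ)` with `φ` concave, viewed as a sum of `φ` over increments
of partial sums. It reverses majorization and is supermodular. The meet has partial sums `min F G`;
with the sequence `max F G` in place of the join, the inequality holds increment by increment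
(`sum_increments_min_max`). That sequence need not be concave; the join is its least concave
majorant, and passing to it only increases the sum (`sum_increments_le`): after tangent lines and
summation by parts, each term contains either the gap between the two sequences or a change of slope
of the majorant, and the majorant is straight wherever the gap is positive (`cumSum_sup_linear`).

Each Sharma–Mittal entropy is a convex non-decreasing function of such a sum, with `φ x = x ^ α / (1
- α)` or `φ = negMulLog`. Such a function keeps supermodularity because the sum is also antitone
(`comp_sum_supermodular`). The condition `β ≤ α` provides the convexity. -/

/-! ### Convexity inequalities and sums over increments -/

/-- Increments of convex functions: moving two points apart with fixed sum increases the sum. -/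
theorem ConvexOn.add_le_add_of_add_eq {s : Set ℝ} {g : ℝ → ℝ} (hg : ConvexOn ℝ s g) {x y l u : ℝ}
    (hl : l ∈ s) (hu : u ∈ s) (hx : x ∈ Set.Icc l u) (hsum : x + y = l + u) :
    g x + g y ≤ g l + g u := by
  obtain ⟨hlx, hxu⟩ := hx
  rcases hlx.eq_or_lt with rfl | hlx
  · have : y = u := by linarith
    rw [this]
  have hlu : 0 < u - l := by linarith
  have key : ∀ a b : ℝ, 0 ≤ a → 0 ≤ b → a + b = u - l →
      (u - l) * g ((a * l + b * u) / (u - l)) ≤ a * g l + b * g u := by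
    intro a b ha hb hab
    have h := hg.2 hl hu (div_nonneg ha hlu.le) (div_nonneg hb hlu.le)
      (by rw [← add_div, hab, div_self hlu.ne'])
    simp only [smul_eq_mul] at h
    have e : (a * l + b * u) / (u - l) = a / (u - l) * l + b / (u - l) * u := by ring
    rw [e]
    calc (u - l) * g (a / (u - l) * l + b / (u - l) * u)
        ≤ (u - l) * (a / (u - l) * g l + b / (u - l) * g u) :=
          mul_le_mul_of_nonneg_left h hlu.le
      _ = a * g l + b * g u := by field_simp
  have h₁ := key (u - x) (x - l) (by linarith) (by linarith) (by ring)
  have h₂ := key (x - l) (u - x) (by linarith) (by linarith) (by ring)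
  have e₁ : ((u - x) * l + (x - l) * u) / (u - l) = x := by field_simp; ring
  have e₂ : ((x - l) * l + (u - x) * u) / (u - l) = y := by
    rw [show y = l + u - x by linarith]; field_simp; ring
  rw [e₁] at h₁
  rw [e₂] at h₂
  refine le_of_mul_le_mul_left ?_ hlu
  linarith

theorem ConcaveOn.add_le_add_of_add_eq {s : Set ℝ} {g : ℝ → ℝ} (hg : ConcaveOn ℝ s g)
    {x y l u : ℝ} (hl : l ∈ s) (hu : u ∈ s) (hx : x ∈ Set.Icc l u) (hsum : x + y = l + u) :
    g l + g u ≤ g x + g y := by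
  have := hg.neg.add_le_add_of_add_eq hl hu hx hsum
  simp only [Pi.neg_apply] at this
  linarith

/-- A non-decreasing convex function preserves submodular-type inequalities. -/
theorem ConvexOn.add_le_add_of_monotoneOn {s : Set ℝ} {g : ℝ → ℝ} (hg : ConvexOn ℝ s g)
    (hm : MonotoneOn g s) {x y l u : ℝ} (hl : l ∈ s) (hu : u ∈ s) (hx : x ∈ Set.Icc l u)
    (hy : y ∈ Set.Icc l u) (hsum : x + y ≤ l + u) : g x + g y ≤ g l + g u := by
  -- Lowering `u` to `x + y - l` makes the two sums equal; monotonicity then restores `u`.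
  have hmem : x + y - l ∈ s :=
    hg.1.ordConnected.out hl hu ⟨by linarith [hx.1, hy.1], by linarith⟩
  have h₁ := hg.add_le_add_of_add_eq (x := x) (y := y) hl hmem
    ⟨hx.1, by linarith [hy.1]⟩ (by ring)
  have h₂ := hm hmem hu (by linarith)
  linarith

/-- The tangent line of a concave function lies above its graph. -/
theorem ConcaveOn.le_tangent {s : Set ℝ} {f : ℝ → ℝ} (hf : ConcaveOn ℝ s f) {x y f' : ℝ}
    (hx : x ∈ s) (hy : y ∈ s) (hd : HasDerivAt f f' x) : f y ≤ f x + f' * (y - x) := by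
  rcases lt_trichotomy x y with h | rfl | h
  · have := hf.slope_le_of_hasDerivAt hx hy h hd
    rw [slope_def_field, div_le_iff₀ (by linarith)] at this
    linarith
  · simp
  · have := hf.le_slope_of_hasDerivAt hy hx h hd
    rw [slope_def_field, le_div_iff₀ (by linarith)] at this
    linarith

/-- Summation by parts for a sequence vanishing at both ends. -/
theorem sum_range_mul_sub_nonpos {n : ℕ} {D c : ℕ → ℝ} (h0 : D 0 = 0) (hn : D n = 0)
    (h : ∀ k, k + 1 < n → 0 ≤ D (k + 1) * (c (k + 1) - c k)) :
    ∑ i ∈ Finset.range n, c i * (D (i + 1) - D i) ≤ 0 := by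
  have key : ∀ m, m + 1 ≤ n →
      ∑ i ∈ Finset.range (m + 1), c i * (D (i + 1) - D i) ≤ c m * D (m + 1) := by
    intro m
    induction m with
    | zero => intro _; simp [h0]
    | succ m ih =>
      intro hm
      rw [Finset.sum_range_succ]
      have e₁ := ih (by omega)
      have e₂ := h m (by omega)
      linarith
  rcases n with _ | m
  · simp
  · have := key m le_rfl
    rwa [hn, mul_zero] at this

/-- Comparison of the sums of a concave function over the increments of two sequences. -/
theorem sum_increments_le {n : ℕ} {φ c : ℝ → ℝ} {F L : ℕ → ℝ} (h0 : F 0 = L 0) (hn : F n = L n)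
    (htan : ∀ x y, 0 ≤ x → 0 ≤ y → φ y ≤ φ x + c x * (y - x))
    (hF : ∀ k, k < n → F k ≤ F (k + 1)) (hL : ∀ k, k < n → L k ≤ L (k + 1))
    (h : ∀ k, k + 1 < n →
      0 ≤ (F (k + 1) - L (k + 1)) * (c (L (k + 2) - L (k + 1)) - c (L (k + 1) - L k))) :
    ∑ i ∈ Finset.range n, φ (F (i + 1) - F i) ≤ ∑ i ∈ Finset.range n, φ (L (i + 1) - L i) := by
  have e₁ : ∑ i ∈ Finset.range n, φ (F (i + 1) - F i) ≤ ∑ i ∈ Finset.range n,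
      (φ (L (i + 1) - L i)
        + c (L (i + 1) - L i) * ((F (i + 1) - L (i + 1)) - (F i - L i))) := by
    refine Finset.sum_le_sum fun i hi => ?_
    have hi := Finset.mem_range.mp hi
    have := htan (L (i + 1) - L i) (F (i + 1) - F i) (sub_nonneg.mpr (hL i hi))
      (sub_nonneg.mpr (hF i hi))
    linarith
  have e₂ := sum_range_mul_sub_nonpos (n := n) (D := fun i => F i - L i)
    (c := fun i => c (L (i + 1) - L i)) (sub_eq_zero.mpr h0) (sub_eq_zero.mpr hn) h
  rw [Finset.sum_add_distrib] at e₁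
  linarith

/-- If the sequences do not cross at a step, the increments are merely permuted. If they cross, the
increments of `min` and `max` have the same total and lie between the original two, so concavity
applies. -/
theorem sum_increments_min_max {n : ℕ} {φ : ℝ → ℝ} (hφ : ConcaveOn ℝ (Set.Ici 0) φ) {F G : ℕ → ℝ}
    (hF : ∀ k, k < n → F k ≤ F (k + 1)) (hG : ∀ k, k < n → G k ≤ G (k + 1)) :
    ∑ i ∈ Finset.range n, φ (F (i + 1) - F i) + ∑ i ∈ Finset.range n, φ (G (i + 1) - G i) ≤
      ∑ i ∈ Finset.range n, φ (min (F (i + 1)) (G (i + 1)) - min (F i) (G i)) +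
        ∑ i ∈ Finset.range n, φ (max (F (i + 1)) (G (i + 1)) - max (F i) (G i)) := by
  rw [← Finset.sum_add_distrib, ← Finset.sum_add_distrib]
  refine Finset.sum_le_sum fun i hi => ?_
  have hi := Finset.mem_range.mp hi
  have hf := sub_nonneg.mpr (hF i hi)
  have hg := sub_nonneg.mpr (hG i hi)
  rcases le_total (F i) (G i) with h₁ | h₁ <;>
    rcases le_total (F (i + 1)) (G (i + 1)) with h₂ | h₂ <;>
    simp only [h₁, h₂, min_eq_left, min_eq_right, max_eq_left, max_eq_right]
  · exact le_rfl
  · rw [add_comm (φ (F (i + 1) - F i))]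
    exact hφ.add_le_add_of_add_eq hg hf ⟨by linarith, by linarith⟩ (by ring)
  · exact hφ.add_le_add_of_add_eq hf hg ⟨by linarith, by linarith⟩ (by ring)
  · rw [add_comm]

/-! ### Trace-form entropies on the majorization lattice -/

namespace OrderedSimplex

variable {n : ℕ}

theorem sum_val_eq_sum_range (φ : ℝ → ℝ) (p : OrderedSimplex n) :
    ∑ i, φ (p.val i) = ∑ i ∈ Finset.range n, φ (p.cumSum (i + 1) - p.cumSum i) := by
  rw [← Fin.sum_univ_eq_sum_range (fun i => φ (p.cumSum (i + 1) - p.cumSum i)) n]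
  refine Finset.sum_congr rfl fun i _ => ?_
  rw [cumSum_succ, add_sub_cancel_left]

theorem cumSum_inf (p q : OrderedSimplex n) {k : ℕ} (hk : k ≤ n) :
    (p ⊓ q).cumSum k = min (p.cumSum k) (q.cumSum k) :=
  cumSum_glb p q hk

/-- The partial sums of `p ⊔ q` are linear wherever they exceed those of `p` and of `q`. -/
theorem cumSum_sup_linear (p q : OrderedSimplex n) {k : ℕ} (hk : k + 1 < n)
    (hlt : max (p.cumSum (k + 1)) (q.cumSum (k + 1)) < (p ⊔ q).cumSum (k + 1)) :
    (p ⊔ q).cumSum (k + 2) - (p ⊔ q).cumSum (k + 1)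
      = (p ⊔ q).cumSum (k + 1) - (p ⊔ q).cumSum k := by
  set H := (p ⊔ q).cumSum with hH
  have hcon := (p ⊔ q).cumSum_concave hk
  by_contra hne
  have hstrict : H k + H (k + 2) < 2 * H (k + 1) :=
    lt_of_le_of_ne hcon fun h => hne (by linarith)
  -- The least value at `k + 1` that stays above `p` and `q` and keeps concavity there. Lowering the
  -- join to `v` at this single index gives a smaller upper bound, a contradiction.
  set v := max (max (p.cumSum (k + 1)) (q.cumSum (k + 1))) ((H k + H (k + 2)) / 2) with hv
  have hv₁ : v < H (k + 1) := max_lt hlt (by linarith)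
  have hv₂ : (H k + H (k + 2)) / 2 ≤ v := le_max_right _ _
  have m₁ := (p ⊔ q).cumSum_le_succ (k := k) (by omega)
  have m₂ := (p ⊔ q).cumSum_le_succ hk
  let F : ℕ → ℝ := Function.update H (k + 1) v
  have hFv : F (k + 1) = v := Function.update_self _ _ _
  have hFne : ∀ j, j ≠ k + 1 → F j = H j := fun j hj => Function.update_of_ne hj _ _
  have hFle : ∀ j, F j ≤ H j := by
    intro j
    by_cases hj : j = k + 1
    · rw [hj, hFv]; exact hv₁.le
    · rw [hFne j hj]
  let r : OrderedSimplex n := ofCumSum F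
    (by rw [hFne 0 (by omega)]; exact cumSum_zero _)
    (by rw [hFne n (by omega)]; exact cumSum_last _)
    (by
      intro j hj
      by_cases h₁ : j = k + 1
      · subst h₁
        rw [hFv, hFne _ (by omega)]
        linarith
      · rw [hFne j h₁]
        by_cases h₂ : j = k
        · subst h₂
          rw [hFv]
          linarith
        · rw [hFne _ (by omega)]
          exact cumSum_le_succ _ hj)
    (by
      intro j hj
      by_cases h₁ : j = k
      · subst h₁
        rw [hFv, hFne _ (by omega), hFne _ (by omega)]
        linarith
      -- The middle term is unchanged and the outer terms can only drop, so concavity persists.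
      · rw [hFne (j + 1) (by omega)]
        exact (add_le_add (hFle _) (hFle _)).trans (cumSum_concave _ hj))
  have hr : ∀ j, j ≤ n → r.cumSum j = F j := fun j hj => cumSum_ofCumSum _ _ _ _ _ hj
  have hup : ∀ s : OrderedSimplex n, s ≤ p ⊔ q →
      s.cumSum (k + 1) ≤ max (p.cumSum (k + 1)) (q.cumSum (k + 1)) → s ≤ r := by
    intro s hs hs' j hj hjn
    rw [hr j hjn]
    by_cases h : j = k + 1
    · rw [h, hFv]
      exact hs'.trans (le_max_left _ _)
    · rw [hFne j h]
      exact hs j hj hjn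
  have hle : p ⊔ q ≤ r :=
    sup_le (hup p le_sup_left (le_max_left _ _)) (hup q le_sup_right (le_max_right _ _))
  have := hle (k + 1) (by omega) hk.le
  rw [hr _ hk.le, hFv] at this
  exact absurd hv₁ (not_lt.mpr this)

section Tangent

variable {φ c : ℝ → ℝ}

/-- Adding the tangent inequalities at `x` and `y` gives `0 ≤ (c x - c y) * (y - x)`. -/
theorem slope_antitone (htan : ∀ x y, 0 ≤ x → 0 ≤ y → φ y ≤ φ x + c x * (y - x)) {x y : ℝ}
    (hx : 0 ≤ x) (hxy : x ≤ y) : c y ≤ c x := by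
  rcases hxy.eq_or_lt with rfl | hlt
  · exact le_rfl
  have h₁ := htan x y hx (hx.trans hxy)
  have h₂ := htan y x (hx.trans hxy) hx
  by_contra! h
  nlinarith [mul_pos (sub_pos.mpr h) (sub_pos.mpr hlt)]

theorem sum_antitone_of_tangent
    (htan : ∀ x y, 0 ≤ x → 0 ≤ y → φ y ≤ φ x + c x * (y - x)) {p q : OrderedSimplex n}
    (hpq : p ≤ q) : ∑ i, φ (q.val i) ≤ ∑ i, φ (p.val i) := by
  rw [sum_val_eq_sum_range, sum_val_eq_sum_range]
  refine sum_increments_le (c := c) (F := q.cumSum) (L := p.cumSum)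
    (by rw [cumSum_zero, cumSum_zero])
    (by rw [cumSum_last, cumSum_last]) htan (fun k hk => q.cumSum_le_succ hk)
    (fun k hk => p.cumSum_le_succ hk) fun k hk => mul_nonneg ?_ ?_
  · exact sub_nonneg.mpr (hpq (k + 1) (by omega) hk.le)
  · refine sub_nonneg.mpr (slope_antitone htan (sub_nonneg.mpr (p.cumSum_le_succ hk)) ?_)
    linarith [p.cumSum_concave hk]

theorem sum_supermodular_of_tangent (hφ : ConcaveOn ℝ (Set.Ici 0) φ)
    (htan : ∀ x y, 0 ≤ x → 0 ≤ y → φ y ≤ φ x + c x * (y - x)) (p q : OrderedSimplex n) :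
    ∑ i, φ (p.val i) + ∑ i, φ (q.val i)
      ≤ ∑ i, φ ((p ⊓ q).val i) + ∑ i, φ ((p ⊔ q).val i) := by
  simp only [sum_val_eq_sum_range]
  refine (sum_increments_min_max hφ (F := p.cumSum) (G := q.cumSum) (fun k hk => p.cumSum_le_succ hk)
    (fun k hk => q.cumSum_le_succ hk)).trans (add_le_add (Finset.sum_le_sum fun i hi => ?_) ?_)
  · have hi := Finset.mem_range.mp hi
    rw [cumSum_inf p q hi.le, cumSum_inf p q hi]
  · refine sum_increments_le (c := c) (F := fun i => max (p.cumSum i) (q.cumSum i))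
      (L := (p ⊔ q).cumSum)
      (by simp only [cumSum_zero, max_self]) (by simp only [cumSum_last, max_self]) htan
      (fun k hk => max_le_max (p.cumSum_le_succ hk) (q.cumSum_le_succ hk))
      (fun k hk => cumSum_le_succ _ hk) fun k hk => ?_
    have hle : max (p.cumSum (k + 1)) (q.cumSum (k + 1)) ≤ (p ⊔ q).cumSum (k + 1) :=
      max_le (cumSum_mono le_sup_left hk.le) (cumSum_mono le_sup_right hk.le)
    -- Either the majorant touches the maximum, or its slope does not change.
    rcases hle.eq_or_lt with h | h
    · rw [h, sub_self, zero_mul]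
    · rw [cumSum_sup_linear p q hk h, sub_self, mul_zero]

end Tangent

section Concave

variable {φ : ℝ → ℝ}

theorem concaveOn_comp_add_const (hφ : ConcaveOn ℝ (Set.Ici 0) φ) {ε : ℝ} (hε : 0 ≤ ε) :
    ConcaveOn ℝ (Set.Ici 0) fun x => φ (x + ε) := by
  refine (hφ.translate_left ε).subset (fun x hx => ?_) (convex_Ici 0)
  have : 0 ≤ x := hx
  simp only [Set.mem_preimage, Set.mem_Ici]
  linarith

/-- The slope of `φ` may be infinite at `0`, as for `negMulLog`. Shifting by `ε > 0` makes tangents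
available on all of `[0, ∞)`; the limit `ε → 0` then removes the shift. -/
theorem exists_slope_comp_add_const (hφ : ConcaveOn ℝ (Set.Ici 0) φ)
    (hd : ∀ x, 0 < x → DifferentiableAt ℝ φ x) {ε : ℝ} (hε : 0 < ε) :
    ∀ x y, 0 ≤ x → 0 ≤ y → φ (y + ε) ≤ φ (x + ε) + deriv φ (x + ε) * (y - x) := by
  intro x y hx hy
  have := hφ.le_tangent (x := x + ε) (y := y + ε) (Set.mem_Ici.mpr (by linarith))
    (Set.mem_Ici.mpr (by linarith)) (hd (x + ε) (by linarith)).hasDerivAt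
  rwa [add_sub_add_right_eq_sub] at this

theorem tendsto_sum_comp_add_const (hc : Continuous φ) (p : OrderedSimplex n) :
    Filter.Tendsto (fun ε => ∑ i, φ (p.val i + ε)) (nhdsWithin 0 (Set.Ioi 0))
      (nhds (∑ i, φ (p.val i))) := by
  have h : Continuous fun ε => ∑ i, φ (p.val i + ε) := by fun_prop
  simpa using (h.tendsto 0).mono_left nhdsWithin_le_nhds

theorem sum_antitone (hφ : ConcaveOn ℝ (Set.Ici 0) φ) (hc : Continuous φ)
    (hd : ∀ x, 0 < x → DifferentiableAt ℝ φ x) {p q : OrderedSimplex n} (hpq : p ≤ q) :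
    ∑ i, φ (q.val i) ≤ ∑ i, φ (p.val i) := by
  refine le_of_tendsto_of_tendsto (tendsto_sum_comp_add_const hc q)
    (tendsto_sum_comp_add_const hc p) ?_
  filter_upwards [self_mem_nhdsWithin] with ε hε
  exact sum_antitone_of_tangent (φ := fun x => φ (x + ε)) (c := fun x => deriv φ (x + ε))
    (exists_slope_comp_add_const hφ hd hε) hpq

theorem sum_supermodular (hφ : ConcaveOn ℝ (Set.Ici 0) φ) (hc : Continuous φ)
    (hd : ∀ x, 0 < x → DifferentiableAt ℝ φ x) (p q : OrderedSimplex n) :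
    ∑ i, φ (p.val i) + ∑ i, φ (q.val i)
      ≤ ∑ i, φ ((p ⊓ q).val i) + ∑ i, φ ((p ⊔ q).val i) := by
  refine le_of_tendsto_of_tendsto
    ((tendsto_sum_comp_add_const hc p).add (tendsto_sum_comp_add_const hc q))
    ((tendsto_sum_comp_add_const hc _).add (tendsto_sum_comp_add_const hc _)) ?_
  filter_upwards [self_mem_nhdsWithin] with ε hε
  exact sum_supermodular_of_tangent (φ := fun x => φ (x + ε))
    (c := fun x => deriv φ (x + ε)) (concaveOn_comp_add_const hφ (le_of_lt hε))
    (exists_slope_comp_add_const hφ hd hε) p q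

/-- A non-decreasing convex function of a trace-form entropy is supermodular. -/
theorem comp_sum_supermodular (hφ : ConcaveOn ℝ (Set.Ici 0) φ) (hc : Continuous φ)
    (hd : ∀ x, 0 < x → DifferentiableAt ℝ φ x) {s : Set ℝ} {g : ℝ → ℝ} (hg : ConvexOn ℝ s g)
    (hm : MonotoneOn g s) (hs : ∀ p : OrderedSimplex n, ∑ i, φ (p.val i) ∈ s)
    (p q : OrderedSimplex n) :
    g (∑ i, φ (p.val i)) + g (∑ i, φ (q.val i))
      ≤ g (∑ i, φ ((p ⊓ q).val i)) + g (∑ i, φ ((p ⊔ q).val i)) := by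
  have anti : ∀ {r t : OrderedSimplex n}, r ≤ t → _ := fun h => sum_antitone hφ hc hd h
  -- The sum reverses the order: the join supplies the left endpoint, the meet the right one.
  rw [add_comm (g (∑ i, φ ((p ⊓ q).val i)))]
  refine hg.add_le_add_of_monotoneOn hm (hs _) (hs _) ⟨anti le_sup_left, anti inf_le_left⟩
    ⟨anti le_sup_right, anti inf_le_right⟩ ?_
  rw [add_comm (∑ i, φ ((p ⊔ q).val i))]
  exact sum_supermodular hφ hc hd p q

end Concave

end OrderedSimplex

/-! ### Power sums, Shannon entropy and the outer functions -/

/-- The power is the exponential of the convex function `r * log x`. -/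
theorem convexOn_rpow_of_nonpos {r : ℝ} (hr : r ≤ 0) :
    ConvexOn ℝ (Set.Ioi 0) fun x : ℝ => x ^ r := by
  have h₁ : ConvexOn ℝ (Set.Ioi 0) fun x => r * Real.log x := by
    have := strictConcaveOn_log_Ioi.concaveOn.neg.smul (neg_nonneg.mpr hr)
    refine this.congr fun x _ => ?_
    simp
  refine ⟨convex_Ioi 0, fun x hx y hy a b ha hb hab => ?_⟩
  have hxy := (convex_Ioi (0 : ℝ)) hx hy ha hb hab
  have e₁ := h₁.2 hx hy ha hb hab
  have e₂ := convexOn_exp.2 (Set.mem_univ (r * Real.log x)) (Set.mem_univ (r * Real.log y)) ha hb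
    hab
  have hpow : ∀ z : ℝ, z ∈ Set.Ioi (0 : ℝ) → z ^ r = Real.exp (r * Real.log z) := fun z hz => by
    rw [Real.rpow_def_of_pos hz, mul_comm]
  simp only [hpow x hx, hpow y hy, hpow _ hxy]
  exact (Real.exp_le_exp.mpr e₁).trans e₂

namespace OrderedSimplex

variable {n : ℕ}

theorem sum_rpow_pos (α : ℝ) (p : OrderedSimplex n) : 0 < ∑ i, p.val i ^ α := by
  obtain ⟨i, hi⟩ : ∃ i, p.val i ≠ 0 := by
    by_contra! h
    have := p.sum_eq_one
    simp [h] at this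
  exact Finset.sum_pos' (fun j _ => Real.rpow_nonneg (p.nonneg j) α)
    ⟨i, Finset.mem_univ i, Real.rpow_pos_of_pos (lt_of_le_of_ne (p.nonneg i) hi.symm) α⟩

/-- The divisor changes sign exactly where `x ^ α` turns from concave to convex. -/
theorem concaveOn_rpow_div {α : ℝ} (hα : 0 < α) (h1 : α ≠ 1) :
    ConcaveOn ℝ (Set.Ici 0) fun x : ℝ => x ^ α / (1 - α) := by
  rcases h1.lt_or_gt with h | h
  · have := (Real.concaveOn_rpow hα.le h.le).smul (inv_nonneg.mpr (sub_nonneg.mpr h.le))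
    refine this.congr fun x _ => ?_
    simp [div_eq_inv_mul]
  · have := (convexOn_rpow h.le).neg.smul (inv_nonneg.mpr (sub_nonneg.mpr h.le))
    refine this.congr fun x _ => ?_
    simp only [Pi.neg_apply, smul_eq_mul, div_eq_inv_mul]
    rw [← neg_sub α 1, inv_neg]
    ring

/-- A function of the power sum `∑ pᵢ ^ α` is supermodular if it is convex, and non-decreasing or
non-increasing according to whether `α < 1` or `α > 1`. -/
theorem comp_sum_rpow_supermodular {α : ℝ} (hα : 0 < α) (h1 : α ≠ 1) {h : ℝ → ℝ}
    (hh : ConvexOn ℝ (Set.Ioi 0) h) (hmono : α < 1 → MonotoneOn h (Set.Ioi 0))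
    (hanti : 1 < α → AntitoneOn h (Set.Ioi 0)) (p q : OrderedSimplex n) :
    h (∑ i, p.val i ^ α) + h (∑ i, q.val i ^ α)
      ≤ h (∑ i, (p ⊓ q).val i ^ α) + h (∑ i, (p ⊔ q).val i ^ α) := by
  have h1' : 1 - α ≠ 0 := sub_ne_zero.mpr h1.symm
  have hsum : ∀ r : OrderedSimplex n,
      (1 - α) * ∑ i, r.val i ^ α / (1 - α) = ∑ i, r.val i ^ α := by
    intro r
    rw [← Finset.sum_div, mul_div_cancel₀ _ h1']
  -- Precomposing with multiplication by `1 - α` undoes the normalization of `φ`; for `α > 1` it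
  -- turns an antitone `h` into a monotone function.
  have hg := hh.comp_linearMap (LinearMap.mulLeft ℝ (1 - α))
  have key := comp_sum_supermodular (n := n) (φ := fun x => x ^ α / (1 - α))
    (concaveOn_rpow_div hα h1) ((Real.continuous_rpow_const hα.le).div_const _)
    (fun x hx => (Real.differentiableAt_rpow_const_of_ne α hx.ne').div_const _) hg ?_ ?_ p q
  · simpa only [Function.comp_apply, LinearMap.mulLeft_apply, hsum] using key
  · intro x hx y hy hxy
    rcases h1.lt_or_gt with hlt | hgt
    · exact hmono hlt hx hy (mul_le_mul_of_nonneg_left hxy (by linarith))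
    · exact hanti hgt hy hx (mul_le_mul_of_nonpos_left hxy (by linarith))
  · intro r
    simp only [Set.mem_preimage, LinearMap.mulLeft_apply, hsum, Set.mem_Ioi]
    exact sum_rpow_pos α r

theorem comp_sum_negMulLog_supermodular {g : ℝ → ℝ} (hg : ConvexOn ℝ Set.univ g)
    (hm : Monotone g) (p q : OrderedSimplex n) :
    g (∑ i, Real.negMulLog (p.val i)) + g (∑ i, Real.negMulLog (q.val i))
      ≤ g (∑ i, Real.negMulLog ((p ⊓ q).val i)) + g (∑ i, Real.negMulLog ((p ⊔ q).val i)) :=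
  comp_sum_supermodular Real.concaveOn_negMulLog Real.continuous_negMulLog
    (fun _ hx => (Real.hasDerivAt_negMulLog hx.ne').differentiableAt) hg (hm.monotoneOn _)
    (fun _ => Set.mem_univ _) p q

theorem shannonEntropy_eq (p : OrderedSimplex n) :
    shannonEntropy p = (∑ i, Real.negMulLog (p.val i)) / Real.log 2 := by
  rw [shannonEntropy, Finset.sum_div, ← Finset.sum_neg_distrib]
  refine Finset.sum_congr rfl fun i _ => ?_
  rw [Real.negMulLog, Real.logb]
  ring

theorem log_two_mul_shannonEntropy (p : OrderedSimplex n) :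
    Real.log 2 * shannonEntropy p = ∑ i, Real.negMulLog (p.val i) := by
  rw [shannonEntropy_eq, mul_div_cancel₀ _ (Real.log_pos one_lt_two).ne']

theorem log_two_mul_renyiEntropy {α : ℝ} (h1 : α ≠ 1) (p : OrderedSimplex n) :
    Real.log 2 * renyiEntropy α p = (1 / (1 - α)) * Real.log (∑ i, p.val i ^ α) := by
  rw [renyiEntropy, if_neg h1, Real.logb]
  have := (Real.log_pos one_lt_two).ne'
  field_simp

theorem two_rpow_mul_shannonEntropy (t : ℝ) (p : OrderedSimplex n) :
    (2 : ℝ) ^ (t * shannonEntropy p) = Real.exp (t * ∑ i, Real.negMulLog (p.val i)) := by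
  rw [← log_two_mul_shannonEntropy, Real.rpow_def_of_pos two_pos]
  ring_nf

/-- Here `β ≤ α` controls the exponent. For `β < 1` it is at least `1` when `α < 1` and negative
when `α > 1`, so the power is convex. For `β > 1` it lies in `[0, 1]`, and the negative prefactor
turns concave into convex. -/
theorem convexOn_sharmaMittal {α β : ℝ} (h1 : α ≠ 1) (hβ1 : β ≠ 1) (hβ : β ≤ α) :
    ConvexOn ℝ (Set.Ioi 0) fun x : ℝ =>
      1 / (1 - β) * (x ^ ((1 - β) / (1 - α)) - 1) := by
  rcases hβ1.lt_or_gt with hb | hb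
  · have hpow : ConvexOn ℝ (Set.Ioi 0) fun x : ℝ => x ^ ((1 - β) / (1 - α)) := by
      rcases h1.lt_or_gt with ha | ha
      · exact (convexOn_rpow ((one_le_div (by linarith)).mpr (by linarith))).subset
          Set.Ioi_subset_Ici_self (convex_Ioi 0)
      · exact convexOn_rpow_of_nonpos
          (div_nonpos_of_nonneg_of_nonpos (by linarith) (by linarith))
    exact (hpow.add_const (-1)).smul (one_div_nonneg.mpr (by linarith : 0 ≤ 1 - β))
  · have ha : 1 < α := hb.trans_le hβ
    have hpow : ConcaveOn ℝ (Set.Ioi 0) fun x : ℝ => x ^ ((1 - β) / (1 - α)) := by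
      refine (Real.concaveOn_rpow (div_nonneg_of_nonpos (by linarith) (by linarith)) ?_).subset
          Set.Ioi_subset_Ici_self (convex_Ioi 0)
      rw [div_le_one_of_neg (by linarith)]
      linarith
    have := (hpow.add_const (-1)).neg.smul (one_div_nonneg.mpr (by linarith : 0 ≤ β - 1))
    refine this.congr fun x _ => ?_
    simp only [Pi.neg_apply, Pi.add_apply, smul_eq_mul]
    rw [← neg_sub β 1, one_div, one_div, inv_neg]
    ring

theorem monotoneOn_sharmaMittal {α β : ℝ} (ha : α < 1) (hβ : β ≤ α) :
    MonotoneOn (fun x : ℝ => 1 / (1 - β) * (x ^ ((1 - β) / (1 - α)) - 1)) (Set.Ioi 0) := by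
  intro x hx y _ hxy
  refine mul_le_mul_of_nonneg_left (sub_le_sub_right (Real.rpow_le_rpow (le_of_lt hx) hxy
    (div_nonneg (by linarith) (by linarith))) 1) (one_div_nonneg.mpr (by linarith))

theorem antitoneOn_sharmaMittal {α β : ℝ} (ha : 1 < α) :
    AntitoneOn (fun x : ℝ => 1 / (1 - β) * (x ^ ((1 - β) / (1 - α)) - 1)) (Set.Ioi 0) := by
  intro x hx y _ hxy
  rcases le_total β 1 with hb | hb
  · refine mul_le_mul_of_nonneg_left (sub_le_sub_right (Real.rpow_le_rpow_of_nonpos hx hxy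
      (div_nonpos_of_nonneg_of_nonpos (by linarith) (by linarith))) 1)
      (one_div_nonneg.mpr (by linarith))
  · refine mul_le_mul_of_nonpos_left (sub_le_sub_right (Real.rpow_le_rpow (le_of_lt hx) hxy
      (div_nonneg_of_nonpos (by linarith) (by linarith))) 1)
      (one_div_nonpos.mpr (by linarith))

end OrderedSimplex

/-! ### Supermodularity in the four parameter cases -/

theorem theorem2 {n : ℕ} (α β : ℝ) (hα : 0 < α) (hβ : β ≤ α) (p q : OrderedSimplex n) :
    OrderedSimplex.sharmaMittalEntropy α β p + OrderedSimplex.sharmaMittalEntropy α β q ≤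
      OrderedSimplex.sharmaMittalEntropy α β (p ⊓ q) +
        OrderedSimplex.sharmaMittalEntropy α β (p ⊔ q) := by
  unfold OrderedSimplex.sharmaMittalEntropy
  by_cases hβ1 : β = 1
  · simp only [if_pos hβ1]
    by_cases h1 : α = 1
    · simp only [OrderedSimplex.renyiEntropy, if_pos h1,
        OrderedSimplex.log_two_mul_shannonEntropy]
      exact OrderedSimplex.comp_sum_negMulLog_supermodular (g := id) (convexOn_id convex_univ)
        monotone_id p q
    · have ha : 1 < α := lt_of_le_of_ne (hβ1 ▸ hβ) (Ne.symm h1)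
      simp only [OrderedSimplex.log_two_mul_renyiEntropy h1]
      have hc : 1 / (1 - α) ≤ 0 := one_div_nonpos.mpr (by linarith)
      refine OrderedSimplex.comp_sum_rpow_supermodular
        (h := fun x => 1 / (1 - α) * Real.log x) hα h1 ?_ (fun h => absurd h (not_lt.mpr ha.le))
        (fun _ x hx y _ hxy => mul_le_mul_of_nonpos_left (Real.log_le_log hx hxy) hc) p q
      refine (strictConcaveOn_log_Ioi.concaveOn.neg.smul (neg_nonneg.mpr hc)).congr fun x _ => ?_
      simp
  · simp only [if_neg hβ1]
    by_cases h1 : α = 1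
    · simp only [if_pos h1, OrderedSimplex.two_rpow_mul_shannonEntropy]
      have hb : 0 < 1 - β := sub_pos.mpr (lt_of_le_of_ne (h1 ▸ hβ) hβ1)
      refine OrderedSimplex.comp_sum_negMulLog_supermodular
        (g := fun x => (Real.exp ((1 - β) * x) - 1) / (1 - β)) ?_ (fun x y hxy => ?_) p q
      · refine (((convexOn_exp.comp_linearMap (LinearMap.mulLeft ℝ (1 - β))).add_const
          (-1)).smul (inv_nonneg.mpr hb.le)).congr fun x _ => ?_
        simp only [Pi.add_apply, smul_eq_mul, Function.comp_apply,
          LinearMap.mulLeft_apply]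
        ring
      · exact div_le_div_of_nonneg_right (sub_le_sub_right
          (Real.exp_le_exp.mpr (mul_le_mul_of_nonneg_left hxy hb.le)) 1) hb.le
    · simp only [if_neg h1]
      exact OrderedSimplex.comp_sum_rpow_supermodular hα h1
        (OrderedSimplex.convexOn_sharmaMittal h1 hβ1 hβ)
        (fun h => OrderedSimplex.monotoneOn_sharmaMittal h hβ)
        (fun h => OrderedSimplex.antitoneOn_sharmaMittal h) p q
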